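/- Let $O(3)$ and $SO(3)$ be the groups of real $3\times 3$ orthogonal matrices and of real $3\times 3$ orthogonal matrices of determinant $1$, with their usual topologies. Let $Z_2^{\mathcal T}=\{E,\mathcal T\}$ be the discrete group of order two, and let $SO(3)_s$ and $SO(3)_c$ be two copies of $SO(3)$. Write $R_z(\pi)=\mathrm{diag}(-1,-1,1)$ and $R_x(\pi)=\mathrm{diag}(1,-1,-1)$, and $\eta(g)=\frac{1-\det g}{2}\in\{0,1\}$ for $g\in O(3)$. Let $\Phi=\{\tilde\phi_1,\dots,\tilde\phi_6\}$ be the set of the following six continuous homomorphisms $O(3)\times Z_2^{\mathcal T}\to SO(3)$, where $g\in O(3)$ and $\epsilon\in\{0,1\}$: \[ \tilde\phi_1(g,\mathcal T^\epsilon)=E,\qquad \tilde\phi_2(g,\mathcal T^\epsilon)=R_z(\pi)^{\epsilon},\qquad \tilde\phi_3(g,\mathcal T^\epsilon)=R_z(\pi)^{\eta(g)}, \] \[ \tilde\phi_4(g,\mathcal T^\epsilon)=R_z(\pi)^{\eta(g)+\epsilon},\qquad \tilde\phi_5(g,\mathcal T^\epsilon)=R_z(\pi)^{\eta(g)}R_x(\pi)^{\epsilon},\qquad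 \tilde\phi_6(g,\mathcal T^\epsilon)=(\det g)\,g . \] Call two continuous homomorphisms $f,f':O(3)\times Z_2^{\mathcal T}\to SO(3)_s\times SO(3)_c$ equivalent if there is $b\in SO(3)_s\times SO(3)_c$ with $f'(x)=b\,f(x)\,b^{-1}$ for all $x$. Theorem. The six elements of $\Phi$ are pairwise distinct. Every continuous homomorphism $O(3)\times Z_2^{\mathcal T}\to SO(3)_s\times SO(3)_c$ is equivalent to $x\mapsto(\alpha(x),\beta(x))$ for exactly one ordered pair $(\alpha,\beta)\in\Phi\times\Phi$. Consequently, the continuous homomorphisms $O(3)\times Z_2^{\mathcal T}\to SO(3)_s\times SO(3)_c$ fall into exactly $6^2=36$ equivalence classes. -/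

import Mathlib

noncomputable section

namespace SpinCharge

open Matrix

/-- The orthogonal group `O(3)`, with the topology of entrywise convergence. -/
abbrev O3 : Type := Matrix.orthogonalGroup (Fin 3) ℝ

/-- The rotation group `SO(3)`, with the topology of entrywise convergence. -/
abbrev SO3 : Type := Matrix.specialOrthogonalGroup (Fin 3) ℝ

/-- The group `Z₂^𝒯 = {E, 𝒯}` of order two with the discrete topology; the element `𝒯 ^ ε` is
`Multiplicative.ofAdd ε`. -/
abbrev Z2T : Type := Multiplicative (ZMod 2)

/-- Two continuous homomorphisms `f`, `g` into a group `B` are conjugate if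
`g a = b * f a * b⁻¹` for one element `b` of `B` and all `a`. -/
def Conjugate {A B : Type*} [Monoid A] [TopologicalSpace A] [Group B] [TopologicalSpace B]
    (f g : A →ₜ* B) : Prop :=
  ∃ b : B, ∀ a : A, g a = b * f a * b⁻¹

/-- Conjugacy as an equivalence relation on continuous homomorphisms. -/
def conjugateSetoid (A B : Type*) [Monoid A] [TopologicalSpace A] [Group B]
    [TopologicalSpace B] : Setoid (A →ₜ* B) where
  r := Conjugate
  iseqv :=
    { refl := fun f => ⟨1, fun a => by simp⟩
      symm := by
        rintro f g ⟨b, h⟩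
        exact ⟨b⁻¹, fun a => by simp [h a, mul_assoc]⟩
      trans := by
        rintro f g k ⟨b, h⟩ ⟨c, h'⟩
        exact ⟨c * b, fun a => by simp [h a, h' a, mul_assoc]⟩ }

/-- The rotation `R_z(π)` by the angle `π` about the `z`-axis. -/
def Rz : SO3 :=
  ⟨!![-1, 0, 0; 0, -1, 0; 0, 0, 1], by
    rw [mem_specialOrthogonalGroup_iff, mem_orthogonalGroup_iff]
    refine ⟨?_, by simp [det_fin_three]⟩
    ext i j
    fin_cases i <;> fin_cases j <;> simp [Matrix.mul_apply, Fin.sum_univ_three]⟩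

/-- The rotation `R_x(π)` by the angle `π` about the `x`-axis. -/
def Rx : SO3 :=
  ⟨!![1, 0, 0; 0, -1, 0; 0, 0, -1], by
    rw [mem_specialOrthogonalGroup_iff, mem_orthogonalGroup_iff]
    refine ⟨?_, by simp [det_fin_three]⟩
    ext i j
    fin_cases i <;> fin_cases j <;> simp [Matrix.mul_apply, Fin.sum_univ_three]⟩

theorem Rz_mul_self : Rz * Rz = 1 := by
  apply Subtype.ext
  ext i j
  fin_cases i <;> fin_cases j <;> simp [Rz]

theorem Rx_mul_self : Rx * Rx = 1 := by
  apply Subtype.ext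
  ext i j
  fin_cases i <;> fin_cases j <;> simp [Rx]

theorem Rz_mul_Rx : Rz * Rx = Rx * Rz := by
  apply Subtype.ext
  ext i j
  fin_cases i <;> fin_cases j <;> simp [Rz, Rx]

theorem det_mul_self (g : O3) : g.1.det * g.1.det = 1 := by
  have h := congrArg Matrix.det ((mem_orthogonalGroup_iff (Fin 3) ℝ).mp g.2)
  simpa using h

theorem det_eq (g : O3) : g.1.det = 1 ∨ g.1.det = -1 :=
  mul_self_eq_one_iff.mp (det_mul_self g)

theorem continuous_det : Continuous fun g : O3 => g.1.det :=
  continuous_subtype_val.matrix_det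

open Classical in
/-- `η(g) = (1 - det g) / 2`, an element of `{0, 1}`. -/
def eta (g : O3) : ℕ := if g.1.det = 1 then 0 else 1

theorem eta_cast (g : O3) : (eta g : ℝ) = (1 - g.1.det) / 2 := by
  rcases det_eq g with h | h <;> norm_num [eta, h]

theorem continuous_eta : Continuous eta := by
  refine continuous_discrete_rng.mpr fun n => ?_
  have h : eta ⁻¹' {n} = (fun g : O3 => g.1.det) ⁻¹' Metric.ball (1 - 2 * (n : ℝ)) 1 := by
    ext g
    have hg := eta_cast g
    have hd : g.1.det = 1 - 2 * (eta g : ℝ) := by linarith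
    simp only [Set.mem_preimage, Set.mem_singleton_iff, Metric.mem_ball, Real.dist_eq, hd]
    constructor
    · rintro rfl
      simp
    · intro hlt
      rw [abs_lt] at hlt
      have h1 : (eta g : ℝ) < n + 1 := by linarith
      have h2 : (n : ℝ) < eta g + 1 := by linarith
      have h1' : eta g < n + 1 := by exact_mod_cast h1
      have h2' : n < eta g + 1 := by exact_mod_cast h2
      omega
  rw [h]
  exact Metric.isOpen_ball.preimage continuous_det

theorem pow_eta_mul {p : SO3} (hp : p * p = 1) (g h : O3) :
    p ^ eta (g * h) = p ^ eta g * p ^ eta h := by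
  have hd : (g * h).1.det = g.1.det * h.1.det := Matrix.det_mul _ _
  rcases det_eq g with hg | hg <;> rcases det_eq h with hh | hh <;>
    norm_num [eta, hd, hg, hh, hp]

/-- The exponent `ε ∈ {0, 1}` of the element `𝒯 ^ ε`. -/
def eps (t : Z2T) : ℕ := (Multiplicative.toAdd t).val

theorem pow_eps_mul {c : SO3} (hc : c * c = 1) (s t : Z2T) :
    c ^ eps (s * t) = c ^ eps s * c ^ eps t := by
  have h2 : c ^ 2 = 1 := by rw [pow_two, hc]
  rw [← pow_add, eps, toAdd_mul, ZMod.val_add]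
  exact (pow_eq_pow_mod (eps s + eps t) h2).symm

/-- For commuting `p`, `t` in `SO(3)` with `p² = t² = E`, the continuous homomorphism
`(g, 𝒯 ^ ε) ↦ p ^ η(g) * t ^ ε`. -/
def ofPair (p t : SO3) (hp : p * p = 1) (ht : t * t = 1) (hpt : p * t = t * p) :
    O3 × Z2T →ₜ* SO3 where
  toFun x := p ^ eta x.1 * t ^ eps x.2
  map_one' := by simp [eta, eps]
  map_mul' x y := by
    have hc : Commute (t ^ eps x.2) (p ^ eta y.1) := (Commute.pow_pow hpt _ _).symm
    rw [Prod.fst_mul, Prod.snd_mul, pow_eta_mul hp, pow_eps_mul ht, mul_assoc,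
      ← mul_assoc (p ^ eta y.1), ← hc.eq]
    simp only [mul_assoc]
  continuous_toFun := by
    have h1 : Continuous fun x : O3 × Z2T => (eta x.1, eps x.2) :=
      (continuous_eta.comp continuous_fst).prodMk
        ((continuous_of_discreteTopology (f := eps)).comp continuous_snd)
    exact (continuous_of_discreteTopology
      (f := fun m : ℕ × ℕ => p ^ m.1 * t ^ m.2)).comp h1

/-- `(g, 𝒯 ^ ε) ↦ E`. -/
def phi1 : O3 × Z2T →ₜ* SO3 := 1

/-- `(g, 𝒯 ^ ε) ↦ R_z(π) ^ ε`. -/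
def phi2 : O3 × Z2T →ₜ* SO3 := ofPair 1 Rz (by simp) Rz_mul_self (by simp)

/-- `(g, 𝒯 ^ ε) ↦ R_z(π) ^ η(g)`. -/
def phi3 : O3 × Z2T →ₜ* SO3 := ofPair Rz 1 Rz_mul_self (by simp) (by simp)

/-- `(g, 𝒯 ^ ε) ↦ R_z(π) ^ (η(g) + ε)`. -/
def phi4 : O3 × Z2T →ₜ* SO3 := ofPair Rz Rz Rz_mul_self Rz_mul_self rfl

/-- `(g, 𝒯 ^ ε) ↦ R_z(π) ^ η(g) * R_x(π) ^ ε`. -/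
def phi5 : O3 × Z2T →ₜ* SO3 := ofPair Rz Rx Rz_mul_self Rx_mul_self Rz_mul_Rx

/-- `(g, 𝒯 ^ ε) ↦ (det g) g`. -/
def phi6 : O3 × Z2T →ₜ* SO3 where
  toFun x := ⟨x.1.1.det • x.1.1, by
    have h := det_mul_self x.1
    rw [mem_specialOrthogonalGroup_iff, mem_orthogonalGroup_iff]
    refine ⟨?_, ?_⟩
    · rw [transpose_smul, smul_mul_smul_comm, h, one_smul]
      exact (mem_orthogonalGroup_iff (Fin 3) ℝ).mp x.1.2
    · rw [det_smul, Fintype.card_fin]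
      linear_combination (x.1.1.det * x.1.1.det + 1) * h⟩
  map_one' := by
    apply Subtype.ext
    simp
  map_mul' x y := by
    apply Subtype.ext
    simp [smul_smul, mul_comm]
  continuous_toFun := by
    refine Continuous.subtype_mk ?_ _
    exact (continuous_det.comp continuous_fst).smul
      (continuous_subtype_val.comp continuous_fst)

theorem phi1_apply (x : O3 × Z2T) : phi1 x = 1 := rfl

theorem phi2_apply (x : O3 × Z2T) : phi2 x = Rz ^ eps x.2 := by
  change (1 : SO3) ^ eta x.1 * Rz ^ eps x.2 = _
  simp

theorem phi3_apply (x : O3 × Z2T) : phi3 x = Rz ^ eta x.1 := by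
  change Rz ^ eta x.1 * (1 : SO3) ^ eps x.2 = _
  simp

theorem phi4_apply (x : O3 × Z2T) : phi4 x = Rz ^ (eta x.1 + eps x.2) :=
  (pow_add _ _ _).symm

theorem phi5_apply (x : O3 × Z2T) : phi5 x = Rz ^ eta x.1 * Rx ^ eps x.2 := rfl

theorem phi6_apply (x : O3 × Z2T) : (phi6 x).1 = x.1.1.det • x.1.1 := rfl

/-- The set `Φ` of the six standard homomorphisms `O(3) × Z₂^𝒯 → SO(3)`. -/
def Phi : Set (O3 × Z2T →ₜ* SO3) := {phi1, phi2, phi3, phi4, phi5, phi6}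

end SpinCharge

end

/-!
The target is a product, so the classification reduces to homomorphisms `f` into one copy of
`SO(3)`. As `O(3) × Z₂^𝒯` is the direct product of `SO(3)` and the groups of order two generated
by `-E` and `𝒯` (`eq_rotation_mul`), such an `f` amounts to an endomorphism `ρ` of `SO(3)` and two
commuting elements of square `E` that centralise its image.

The central fact is that `ρ` is trivial or inner, and its proof is purely algebraic: continuity
plays no role. Rotations are conjugate exactly when their traces agree, the half-turns are the
nontrivial involutions, and every rotation is a product of two half-turns; so `ρ` is trivial
(`map_eq_one_of_halfTurn`) or maps half-turns to half-turns. In the second case `tr (ρ A)` is a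
function of `tr A`. Testing the half-turn about a unit vector `u` against the Klein group of
half-turns about the coordinate axes shows that this function, suitably normalised, satisfies
`g (u₀²) + g (u₁²) + g (u₂²) = 1` for all `u`. Such a nonnegative `g` with `g 0 = 0` is the
identity (`eq_self_of_sum_eq_one`), so `ρ` preserves traces (`tr_map_of_nontrivial`). After a
conjugation `ρ` fixes `Rz`, `Rx` and the cyclic permutation of the axes
(`exists_conj_pair`, `exists_diag_conj_cyc`); the group that these generate spans all matrices and
the trace form is nondegenerate, so `ρ` is then the identity (`map_eq_self_of_fix`).

If `ρ` is inner, the images of `-E` and `𝒯` are trivial because `SO(3)` has trivial centre, and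
`f` is conjugate to `phi6`. If `ρ` is trivial, the images of `-E` and `𝒯` are trivial or half-turns;
two distinct commuting half-turns are simultaneously conjugate to `Rz` and `Rx`, and the five cases
give `phi1`, …, `phi5`. The six are not conjugate because they differ in which of `-E`, `𝒯`, `-𝒯`
and `Rz` they kill (`killed_injOn`).
-/

noncomputable section

namespace SpinCharge

open Matrix

/-! ### Rotation matrices and their axes -/

theorem SO3.mul_transpose (A : SO3) : A.1 * A.1ᵀ = 1 :=
  (mem_orthogonalGroup_iff (Fin 3) ℝ).mp (mem_specialOrthogonalGroup_iff.mp A.2).1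

theorem SO3.transpose_mul (A : SO3) : A.1ᵀ * A.1 = 1 :=
  (mem_orthogonalGroup_iff' (Fin 3) ℝ).mp (mem_specialOrthogonalGroup_iff.mp A.2).1

theorem SO3.det_eq_one (A : SO3) : A.1.det = 1 :=
  (mem_specialOrthogonalGroup_iff.mp A.2).2

theorem SO3.coe_inv (A : SO3) : (A⁻¹).1 = A.1ᵀ := rfl

theorem SO3.coe_mul (A B : SO3) : (A * B).1 = A.1 * B.1 := rfl

theorem SO3.row_dot (A : SO3) (i j : Fin 3) :
    A.1 i 0 * A.1 j 0 + A.1 i 1 * A.1 j 1 + A.1 i 2 * A.1 j 2 =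
      (1 : Matrix (Fin 3) (Fin 3) ℝ) i j := by
  have h := congrFun (congrFun A.mul_transpose i) j
  simpa [Matrix.mul_apply, Fin.sum_univ_three] using h

theorem SO3.col_dot (A : SO3) (i j : Fin 3) :
    A.1 0 i * A.1 0 j + A.1 1 i * A.1 1 j + A.1 2 i * A.1 2 j =
      (1 : Matrix (Fin 3) (Fin 3) ℝ) i j := by
  have h := congrFun (congrFun A.transpose_mul i) j
  simpa [Matrix.mul_apply, Fin.sum_univ_three] using h

/-- The trace of a rotation matrix. -/
def tr (A : SO3) : ℝ := A.1.trace

theorem tr_mul_comm (A B : SO3) : tr (A * B) = tr (B * A) :=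
  Matrix.trace_mul_comm _ _

theorem tr_conj (Q A : SO3) : tr (Q * A * Q⁻¹) = tr A := by
  rw [tr_mul_comm, inv_mul_cancel_left]

theorem tr_one : tr 1 = 3 := by
  simp [tr]

/-- The rotation with columns `u`, `v`, `u × v`, for orthonormal `u` and `v`. -/
theorem exists_frame (u v : Fin 3 → ℝ) (hu : u 0 * u 0 + u 1 * u 1 + u 2 * u 2 = 1)
    (hv : v 0 * v 0 + v 1 * v 1 + v 2 * v 2 = 1)
    (huv : u 0 * v 0 + u 1 * v 1 + u 2 * v 2 = 0) :
    ∃ Q : SO3, Q.1 = !![u 0, v 0, u 1 * v 2 - u 2 * v 1;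
                        u 1, v 1, u 2 * v 0 - u 0 * v 2;
                        u 2, v 2, u 0 * v 1 - u 1 * v 0] := by
  refine ⟨⟨_, ?_⟩, rfl⟩
  rw [mem_specialOrthogonalGroup_iff, mem_orthogonalGroup_iff']
  constructor
  · ext i j
    fin_cases i <;> fin_cases j <;>
      simp [Matrix.mul_apply, Fin.sum_univ_three]
    · linear_combination hu
    · linear_combination huv
    · ring
    · linear_combination huv
    · linear_combination hv
    · ring
    · ring
    · ring
    · linear_combination (v 0 * v 0 + v 1 * v 1 + v 2 * v 2) * hu + hv -
        (u 0 * v 0 + u 1 * v 1 + u 2 * v 2) * huv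
  · rw [det_fin_three]
    simp
    linear_combination (v 0 * v 0 + v 1 * v 1 + v 2 * v 2) * hu + hv -
        (u 0 * v 0 + u 1 * v 1 + u 2 * v 2) * huv

theorem exists_orthogonal_unit (u : Fin 3 → ℝ) :
    ∃ v : Fin 3 → ℝ, v 0 * v 0 + v 1 * v 1 + v 2 * v 2 = 1 ∧
      u 0 * v 0 + u 1 * v 1 + u 2 * v 2 = 0 := by
  rcases eq_or_ne (u 0 * u 0 + u 1 * u 1) 0 with h | h
  · refine ⟨![1, 0, 0], by simp, ?_⟩
    have : u 0 = 0 := by nlinarith [mul_self_nonneg (u 0), mul_self_nonneg (u 1)]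
    simp [this]
  · have hpos : 0 < u 0 * u 0 + u 1 * u 1 :=
      lt_of_le_of_ne (add_nonneg (mul_self_nonneg _) (mul_self_nonneg _)) h.symm
    set r := √(u 0 * u 0 + u 1 * u 1)
    have hr0 : r ≠ 0 := (Real.sqrt_pos.mpr hpos).ne'
    have hr2 : r * r = u 0 * u 0 + u 1 * u 1 := Real.mul_self_sqrt hpos.le
    refine ⟨![-u 1 / r, u 0 / r, 0], ?_, ?_⟩
    · simp
      field_simp
      linear_combination -hr2
    · simp
      field_simp
      ring

/-- A rotation has a unit vector on its axis, as
`det (A - 1) = det A * det (1 - Aᵀ) = -det (A - 1)` in odd dimension. -/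
theorem exists_axis (A : SO3) : ∃ u : Fin 3 → ℝ,
    u 0 * u 0 + u 1 * u 1 + u 2 * u 2 = 1 ∧ A.1 *ᵥ u = u := by
  have hdet : (A.1 - 1).det = 0 := by
    have h1 : A.1 - 1 = -(A.1 * (A.1 - 1)ᵀ) := by
      rw [transpose_sub, transpose_one, mul_sub, A.mul_transpose, mul_one, neg_sub]
    have h2 : (A.1 - 1).det = -(A.1 - 1).det := by
      conv_lhs => rw [h1, det_neg, det_mul, A.det_eq_one, det_transpose, Fintype.card_fin]
      ring
    linarith
  obtain ⟨w, hw0, hw⟩ := Matrix.exists_mulVec_eq_zero_iff.mpr hdet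
  have hAw : A.1 *ᵥ w = w := by
    rw [sub_mulVec, one_mulVec, sub_eq_zero] at hw
    exact hw
  have hpos : 0 < w 0 * w 0 + w 1 * w 1 + w 2 * w 2 := by
    by_contra hneg
    apply hw0
    ext i
    fin_cases i <;> simp <;>
      nlinarith [mul_self_nonneg (w 0), mul_self_nonneg (w 1), mul_self_nonneg (w 2)]
  set r := √(w 0 * w 0 + w 1 * w 1 + w 2 * w 2)
  have hr0 : r ≠ 0 := (Real.sqrt_pos.mpr hpos).ne'
  have hr2 : r * r = w 0 * w 0 + w 1 * w 1 + w 2 * w 2 := Real.mul_self_sqrt hpos.le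
  refine ⟨r⁻¹ • w, ?_, by rw [mulVec_smul, hAw]⟩
  simp only [Pi.smul_apply, smul_eq_mul]
  field_simp
  linear_combination -hr2

/-! ### Conjugacy classes of rotations -/

/-- The rotation about the `x`-axis by the angle with cosine `c` and sine `s`. -/
def rotX (c s : ℝ) (h : c * c + s * s = 1) : SO3 :=
  ⟨!![1, 0, 0; 0, c, -s; 0, s, c], by
    rw [mem_specialOrthogonalGroup_iff, mem_orthogonalGroup_iff]
    constructor
    · ext i j
      fin_cases i <;> fin_cases j <;> simp [Matrix.mul_apply, Fin.sum_univ_three] <;>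
        linarith
    · rw [det_fin_three]
      simp
      linear_combination h⟩

theorem tr_rotX (c s : ℝ) (h : c * c + s * s = 1) : tr (rotX c s h) = 1 + 2 * c := by
  simp [tr, rotX, Matrix.trace_fin_three]
  ring

/-- A rotation fixing the first basis vector is a rotation about the `x`-axis. -/
theorem eq_rotX_of_col (B : SO3) (h0 : B.1 0 0 = 1) (h1 : B.1 1 0 = 0) (h2 : B.1 2 0 = 0) :
    ∃ c s h, B = rotX c s h := by
  have r0 : B.1 0 1 * B.1 0 1 + B.1 0 2 * B.1 0 2 = 0 := by
    have := B.row_dot 0 0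
    rw [h0] at this
    simp at this
    linarith
  have h01 : B.1 0 1 = 0 := by
    nlinarith [mul_self_nonneg (B.1 0 1), mul_self_nonneg (B.1 0 2)]
  have h02 : B.1 0 2 = 0 := by
    nlinarith [mul_self_nonneg (B.1 0 1), mul_self_nonneg (B.1 0 2)]
  have hd := B.det_eq_one
  rw [det_fin_three, h0, h01, h02, h1, h2] at hd
  have c11 := B.col_dot 1 1
  have c12 := B.col_dot 1 2
  have c22 := B.col_dot 2 2
  simp [h01, h02] at c11 c12 c22
  have e11 : B.1 2 2 = B.1 1 1 := by
    linear_combination (- B.1 2 2) * c11 + B.1 1 1 * hd + B.1 2 1 * c12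
  have e12 : B.1 1 2 = - B.1 2 1 := by
    linear_combination (- B.1 1 2) * c11 - B.1 2 1 * hd + B.1 1 1 * c12
  refine ⟨B.1 1 1, B.1 2 1, c11, ?_⟩
  apply Subtype.ext
  ext i j
  fin_cases i <;> fin_cases j <;> simp [rotX, h0, h1, h2, h01, h02, e11, e12]

/-- Conjugation by the half-turn about the `z`-axis reverses the angle. -/
theorem Rz_conj_rotX (c s : ℝ) (h : c * c + s * s = 1) :
    Rz * rotX c s h * Rz⁻¹ = rotX c (-s) (by linarith) := by
  apply Subtype.ext
  ext i j
  fin_cases i <;> fin_cases j <;>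
    simp [rotX, Rz, SO3.coe_inv, Matrix.mul_apply, Fin.sum_univ_three]

theorem exists_eq_conj_rotX (A : SO3) :
    ∃ (Q : SO3) (c s : ℝ) (h : c * c + s * s = 1), 0 ≤ s ∧ A = Q * rotX c s h * Q⁻¹ := by
  obtain ⟨u, hu, hAu⟩ := exists_axis A
  obtain ⟨v, hv, huv⟩ := exists_orthogonal_unit u
  obtain ⟨Q, hQ⟩ := exists_frame u v hu hv huv
  have hcol : ∀ i, (Q⁻¹ * A * Q).1 i 0 = (1 : Matrix (Fin 3) (Fin 3) ℝ) i 0 := by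
    intro i
    have hAQ : (A.1 * Q.1) *ᵥ ![1, 0, 0] = Q.1 *ᵥ ![1, 0, 0] := by
      have : Q.1 *ᵥ ![1, 0, 0] = u := by
        rw [hQ]
        ext i
        fin_cases i <;> simp [Matrix.mulVec, dotProduct, Fin.sum_univ_three]
      rw [← mulVec_mulVec, this, hAu]
    have h1 : (Q⁻¹ * A * Q).1 *ᵥ ![1, 0, 0] = ![1, 0, 0] := by
      rw [mul_assoc, SO3.coe_mul, SO3.coe_mul, ← mulVec_mulVec, hAQ, mulVec_mulVec, SO3.coe_inv,
        Q.transpose_mul, one_mulVec]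
    have h2 := congrFun h1 i
    have h3 : ![1, 0, 0] i = (1 : Matrix (Fin 3) (Fin 3) ℝ) i 0 := by
      revert i
      simp [Fin.forall_fin_succ]
    rw [Matrix.mulVec, dotProduct, Fin.sum_univ_three] at h2
    simp only [Matrix.cons_val_zero, Matrix.cons_val_one, Matrix.cons_val, mul_one, mul_zero,
      add_zero] at h2
    rw [h2, h3]
  obtain ⟨c, s, h, hB⟩ := eq_rotX_of_col (Q⁻¹ * A * Q) (by simpa using hcol 0)
    (by simpa using hcol 1) (by simpa using hcol 2)
  have hA : A = Q * rotX c s h * Q⁻¹ := by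
    rw [← hB]
    group
  rcases le_total 0 s with hs | hs
  · exact ⟨Q, c, s, h, hs, hA⟩
  · refine ⟨Q * Rz⁻¹, c, -s, by linarith, by linarith, ?_⟩
    rw [hA, ← Rz_conj_rotX c s h]
    group

theorem exists_conj_of_tr_eq {A B : SO3} (h : tr A = tr B) : ∃ Q : SO3, B = Q * A * Q⁻¹ := by
  obtain ⟨Q, c, s, hcs, hs, rfl⟩ := exists_eq_conj_rotX A
  obtain ⟨Q', c', s', hcs', hs', rfl⟩ := exists_eq_conj_rotX B
  rw [tr_conj, tr_conj, tr_rotX, tr_rotX] at h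
  obtain rfl : c = c' := by linarith
  obtain rfl : s = s' := (mul_self_inj hs hs').mp (by linarith)
  exact ⟨Q' * Q⁻¹, by group⟩

theorem neg_one_le_tr (A : SO3) : -1 ≤ tr A := by
  obtain ⟨Q, c, s, hcs, hs, rfl⟩ := exists_eq_conj_rotX A
  rw [tr_conj, tr_rotX]
  nlinarith [mul_self_nonneg s, mul_self_nonneg (c + 1)]

theorem tr_le_three (A : SO3) : tr A ≤ 3 := by
  obtain ⟨Q, c, s, hcs, hs, rfl⟩ := exists_eq_conj_rotX A
  rw [tr_conj, tr_rotX]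
  nlinarith [mul_self_nonneg s, mul_self_nonneg (c - 1)]

/-! ### Half-turns -/

theorem tr_Rx : tr Rx = -1 := by
  simp [tr, Rx, Matrix.trace_fin_three]

theorem tr_Rz : tr Rz = -1 := by
  simp [tr, Rz, Matrix.trace_fin_three]

theorem mul_self_eq_one_of_tr {A : SO3} (h : tr A = -1) : A * A = 1 := by
  obtain ⟨Q, rfl⟩ := exists_conj_of_tr_eq (tr_Rx.trans h.symm)
  have : Q * Rx * Q⁻¹ * (Q * Rx * Q⁻¹) = Q * (Rx * Rx) * Q⁻¹ := by group
  rw [this, Rx_mul_self]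
  group

theorem ne_one_of_tr {A : SO3} (h : tr A = -1) : A ≠ 1 := by
  rintro rfl
  rw [tr_one] at h
  norm_num at h

/-- The nontrivial involutions of `SO(3)` are the half-turns, the rotations of trace `-1`. -/
theorem tr_of_mul_self_eq_one {A : SO3} (h : A * A = 1) (h1 : A ≠ 1) : tr A = -1 := by
  obtain ⟨Q, c, s, hcs, hs, rfl⟩ := exists_eq_conj_rotX A
  have h2 : rotX c s hcs * rotX c s hcs = 1 := by
    have : Q * rotX c s hcs * Q⁻¹ * (Q * rotX c s hcs * Q⁻¹) =
        Q * (rotX c s hcs * rotX c s hcs) * Q⁻¹ := by group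
    rw [this] at h
    exact conj_eq_one_iff.mp h
  have h3 := congrFun (congrFun (congrArg Subtype.val h2) 1) 1
  simp [rotX] at h3
  have hs0 : s = 0 := by
    have : s * s = 0 := by linarith
    exact mul_self_eq_zero.mp this
  subst hs0
  rcases mul_self_eq_one_iff.mp (by linarith : c * c = 1) with rfl | rfl
  · exfalso
    apply h1
    rw [conj_eq_one_iff]
    apply Subtype.ext
    ext i j
    fin_cases i <;> fin_cases j <;> simp [rotX]
  · rw [tr_conj, tr_rotX]
    norm_num

/-- The rotation permuting the coordinate axes cyclically, `x ↦ y ↦ z ↦ x`. -/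
def cyc : SO3 :=
  ⟨!![0, 0, 1; 1, 0, 0; 0, 1, 0], by
    rw [mem_specialOrthogonalGroup_iff, mem_orthogonalGroup_iff]
    refine ⟨?_, by simp [det_fin_three]⟩
    ext i j
    fin_cases i <;> fin_cases j <;> simp [Matrix.mul_apply, Fin.sum_univ_three]⟩

theorem conj_Rx_apply (Q : SO3) (i j : Fin 3) : (Q * Rx * Q⁻¹).1 i j =
    2 * Q.1 i 0 * Q.1 j 0 - (1 : Matrix (Fin 3) (Fin 3) ℝ) i j := by
  rw [← Q.row_dot i j]
  simp [SO3.coe_inv, Rx, Matrix.mul_apply, Fin.sum_univ_three]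
  ring

/-- A half-turn is `2 u uᵀ - 1` for a unit vector `u` on its axis. -/
theorem exists_axis_of_tr {A : SO3} (h : tr A = -1) : ∃ u : Fin 3 → ℝ,
    u 0 * u 0 + u 1 * u 1 + u 2 * u 2 = 1 ∧
      ∀ i j, A.1 i j = 2 * u i * u j - (1 : Matrix (Fin 3) (Fin 3) ℝ) i j := by
  obtain ⟨Q, rfl⟩ := exists_conj_of_tr_eq (tr_Rx.trans h.symm)
  exact ⟨fun i => Q.1 i 0, by simpa using Q.col_dot 0 0, conj_Rx_apply Q⟩

theorem halfTurn_apply {A : SO3} {u : Fin 3 → ℝ}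
    (hA : ∀ i j, A.1 i j = 2 * u i * u j - (1 : Matrix (Fin 3) (Fin 3) ℝ) i j)
    (w : Fin 3 → ℝ) (i : Fin 3) :
    A.1 i 0 * w 0 + A.1 i 1 * w 1 + A.1 i 2 * w 2 =
      2 * (w 0 * u 0 + w 1 * u 1 + w 2 * u 2) * u i - w i := by
  have h : (1 : Matrix (Fin 3) (Fin 3) ℝ) i 0 * w 0 + (1 : Matrix (Fin 3) (Fin 3) ℝ) i 1 * w 1 +
      (1 : Matrix (Fin 3) (Fin 3) ℝ) i 2 * w 2 = w i := by
    revert i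
    simp [Fin.forall_fin_succ, Matrix.one_apply]
  rw [hA, hA, hA]
  linear_combination -h

/-- Two distinct commuting half-turns are simultaneously conjugate to those about the `x`- and
`z`-axes: their product is again a half-turn, which forces their axes to be orthogonal. -/
theorem exists_conj_pair {P T : SO3} (hP : tr P = -1) (hT : tr T = -1) (hPT : P * T = T * P)
    (hne : P ≠ T) : ∃ b : SO3, b * P * b⁻¹ = Rz ∧ b * T * b⁻¹ = Rx := by
  have htr : tr (P * T) = -1 := by
    apply tr_of_mul_self_eq_one
    · calc P * T * (P * T) = P * (T * P) * T := by group
        _ = (P * P) * (T * T) := by rw [← hPT]; group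
        _ = 1 := by rw [mul_self_eq_one_of_tr hP, mul_self_eq_one_of_tr hT, one_mul]
    · intro h
      apply hne
      rw [mul_eq_one_iff_eq_inv] at h
      rw [h]
      exact inv_eq_of_mul_eq_one_right (mul_self_eq_one_of_tr hT)
  obtain ⟨u, hu, hPu⟩ := exists_axis_of_tr hP
  obtain ⟨v, hv, hTv⟩ := exists_axis_of_tr hT
  have huv : v 0 * u 0 + v 1 * u 1 + v 2 * u 2 = 0 := by
    simp [tr, Matrix.trace_fin_three, Matrix.mul_apply, Fin.sum_univ_three, hPu, hTv] at htr
    have : (v 0 * u 0 + v 1 * u 1 + v 2 * u 2) * (v 0 * u 0 + v 1 * u 1 + v 2 * u 2) = 0 := by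
      linear_combination (1 / 4) * htr + (1 / 2) * hu + (1 / 2) * hv
    exact mul_self_eq_zero.mp this
  -- `Q * cyc` has columns `v`, `u × v`, `u`, so it takes the `x`-axis to the axis of `T` and the
  -- `z`-axis to the axis of `P`.
  obtain ⟨Q, hQ⟩ := exists_frame u v hu hv (by linarith)
  have hPQ : P * (Q * cyc) = Q * cyc * Rz := by
    apply Subtype.ext
    rw [SO3.coe_mul, SO3.coe_mul, SO3.coe_mul, SO3.coe_mul, hQ]
    have h0 := halfTurn_apply hPu v
    have h1 := halfTurn_apply hPu
      ![u 1 * v 2 - u 2 * v 1, u 2 * v 0 - u 0 * v 2, u 0 * v 1 - u 1 * v 0]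
    have h2 := halfTurn_apply hPu u
    simp only [Fin.forall_fin_succ, Fin.succ_zero_eq_one, Fin.succ_one_eq_two,
      Matrix.cons_val_zero, Matrix.cons_val_one, Matrix.cons_val, IsEmpty.forall_iff,
      and_true] at h0 h1 h2
    obtain ⟨h00, h01, h02⟩ := h0
    obtain ⟨h10, h11, h12⟩ := h1
    obtain ⟨h20, h21, h22⟩ := h2
    ext i j
    fin_cases i <;> fin_cases j <;>
      simp [Matrix.mul_apply, Fin.sum_univ_three, cyc, Rz]
    · linear_combination h00 + 2 * u 0 * huv
    · linear_combination h10
    · linear_combination h20 + 2 * u 0 * hu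
    · linear_combination h01 + 2 * u 1 * huv
    · linear_combination h11
    · linear_combination h21 + 2 * u 1 * hu
    · linear_combination h02 + 2 * u 2 * huv
    · linear_combination h12
    · linear_combination h22 + 2 * u 2 * hu
  have hTQ : T * (Q * cyc) = Q * cyc * Rx := by
    apply Subtype.ext
    rw [SO3.coe_mul, SO3.coe_mul, SO3.coe_mul, SO3.coe_mul, hQ]
    have h0 := halfTurn_apply hTv v
    have h1 := halfTurn_apply hTv
      ![u 1 * v 2 - u 2 * v 1, u 2 * v 0 - u 0 * v 2, u 0 * v 1 - u 1 * v 0]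
    have h2 := halfTurn_apply hTv u
    simp only [Fin.forall_fin_succ, Fin.succ_zero_eq_one, Fin.succ_one_eq_two,
      Matrix.cons_val_zero, Matrix.cons_val_one, Matrix.cons_val, IsEmpty.forall_iff,
      and_true] at h0 h1 h2
    obtain ⟨h00, h01, h02⟩ := h0
    obtain ⟨h10, h11, h12⟩ := h1
    obtain ⟨h20, h21, h22⟩ := h2
    ext i j
    fin_cases i <;> fin_cases j <;>
      simp [Matrix.mul_apply, Fin.sum_univ_three, cyc, Rx]
    · linear_combination h00 + 2 * v 0 * hv
    · linear_combination h10
    · linear_combination h20 + 2 * v 0 * huv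
    · linear_combination h01 + 2 * v 1 * hv
    · linear_combination h11
    · linear_combination h21 + 2 * v 1 * huv
    · linear_combination h02 + 2 * v 2 * hv
    · linear_combination h12
    · linear_combination h22 + 2 * v 2 * huv
  refine ⟨(Q * cyc)⁻¹, ?_, ?_⟩
  · rw [mul_assoc, inv_inv, hPQ, inv_mul_cancel_left]
  · rw [mul_assoc, inv_inv, hTQ, inv_mul_cancel_left]

/-! ### Trivial and nontrivial endomorphisms of `SO(3)` -/

theorem tr_Rz_mul_Rx : tr (Rz * Rx) = -1 := by
  simp [tr, Rz, Rx, Matrix.trace_fin_three]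

/-- Every rotation is a product of two half-turns and all half-turns are conjugate, so a
homomorphism that kills one half-turn is trivial. -/
theorem map_eq_one_of_halfTurn {G : Type*} [Group G] (ρ : SO3 →* G) {A : SO3} (hA : tr A = -1)
    (h : ρ A = 1) (B : SO3) : ρ B = 1 := by
  have hall : ∀ C : SO3, tr C = -1 → ρ C = 1 := by
    intro C hC
    obtain ⟨Q, rfl⟩ := exists_conj_of_tr_eq (hA.trans hC.symm)
    simp [h]
  obtain ⟨Q, c, s, hcs, -, rfl⟩ := exists_eq_conj_rotX B
  have h1 : tr (rotX c s hcs * (Rz * Rx)) = -1 := by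
    simp [tr, rotX, Rz, Rx, Matrix.trace_fin_three]
  have h2 := hall _ h1
  rw [map_mul, hall _ tr_Rz_mul_Rx, mul_one] at h2
  simp [h2]

/-- A nonnegative `g` with `g 0 = 0` and `g a + g b + g c = 1` whenever `a, b, c ≥ 0` sum to `1` is the
identity on `[0, 1]`. The defect `g s - s` is additive and odd about `1 / 2`, so its size
at `s` is half of its size at `2 s` or at `2 (1 - s)`. -/
theorem eq_self_of_sum_eq_one {g : ℝ → ℝ} (h0 : g 0 = 0)
    (hg : ∀ s, 0 ≤ g s)
    (hsum : ∀ a b c : ℝ, 0 ≤ a → 0 ≤ b → 0 ≤ c → a + b + c = 1 → g a + g b + g c = 1)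
    {s : ℝ} (hs0 : 0 ≤ s) (hs1 : s ≤ 1) : g s = s := by
  have hrefl : ∀ t : ℝ, 0 ≤ t → t ≤ 1 → g (1 - t) = 1 - g t := by
    intro t ht0 ht1
    have := hsum t 0 (1 - t) ht0 le_rfl (by linarith) (by ring)
    linarith
  have hdouble : ∀ t : ℝ, 0 ≤ t → t ≤ 1 / 2 → g (2 * t) = 2 * g t := by
    intro t ht0 ht1
    have h1 := hsum t t (1 - 2 * t) ht0 ht0 (by linarith) (by ring)
    have h2 := hrefl (2 * t) (by linarith) (by linarith)
    linarith
  have hbound : ∀ (n : ℕ) (t : ℝ), 0 ≤ t → t ≤ 1 → |g t - t| ≤ (1 / 2 : ℝ) ^ n := by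
    intro n
    induction n with
    | zero =>
      intro t ht0 ht1
      have h1 := hg t
      have h2 := hg (1 - t)
      rw [hrefl t ht0 ht1] at h2
      rw [pow_zero, abs_le]
      constructor <;> linarith
    | succ n ih =>
      intro t ht0 ht1
      rw [pow_succ, abs_le]
      rcases le_total t (1 / 2) with ht | ht
      · have h1 := abs_le.mp (ih (2 * t) (by linarith) (by linarith))
        rw [hdouble t ht0 ht] at h1
        constructor <;> linarith
      · have h1 := abs_le.mp (ih (2 * (1 - t)) (by linarith) (by linarith))
        rw [hdouble (1 - t) (by linarith) (by linarith), hrefl t ht0 ht1] at h1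
        constructor <;> linarith
  have hlim := tendsto_pow_atTop_nhds_zero_of_lt_one (r := (1 / 2 : ℝ)) (by norm_num) (by norm_num)
  have hle : |g s - s| ≤ 0 := ge_of_tendsto' hlim fun n => hbound n s hs0 hs1
  linarith [abs_nonpos_iff.mp hle]

theorem tr_mul_fin_three (A B : SO3) : tr (A * B) =
    A.1 0 0 * B.1 0 0 + A.1 0 1 * B.1 1 0 + A.1 0 2 * B.1 2 0 +
    (A.1 1 0 * B.1 0 1 + A.1 1 1 * B.1 1 1 + A.1 1 2 * B.1 2 1) +
    (A.1 2 0 * B.1 0 2 + A.1 2 1 * B.1 1 2 + A.1 2 2 * B.1 2 2) := by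
  simp [tr, Matrix.trace_fin_three, Matrix.mul_apply, Fin.sum_univ_three]

/-- The half-turn about the axis spanned by a unit vector `u`, through its traces against the
half-turns about the coordinate axes. -/
theorem exists_halfTurn (u : Fin 3 → ℝ) (hu : u 0 * u 0 + u 1 * u 1 + u 2 * u 2 = 1) :
    ∃ S : SO3, tr S = -1 ∧ tr (S * Rx) = 4 * (u 0 * u 0) - 1 ∧
      tr (S * (Rz * Rx)) = 4 * (u 1 * u 1) - 1 ∧ tr (S * Rz) = 4 * (u 2 * u 2) - 1 := by
  obtain ⟨v, hv, huv⟩ := exists_orthogonal_unit u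
  obtain ⟨Q, hQ⟩ := exists_frame u v hu hv huv
  refine ⟨Q * Rx * Q⁻¹, by rw [tr_conj, tr_Rx], ?_⟩
  rw [tr_mul_fin_three, tr_mul_fin_three, tr_mul_fin_three]
  simp only [conj_Rx_apply, hQ]
  simp [Rx, Rz]
  refine ⟨?_, ?_, ?_⟩
  · linear_combination -2 * hu
  · linear_combination -2 * hu
  · linear_combination -2 * hu

/-- The four rotations of a Klein group of half-turns sum to zero. -/
theorem sum_klein {P T : SO3} (hP : tr P = -1) (hT : tr T = -1) (hPT : P * T = T * P)
    (hne : P ≠ T) : 1 + P.1 + T.1 + (P * T).1 = 0 := by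
  obtain ⟨b, hb1, hb2⟩ := exists_conj_pair hP hT hPT hne
  have h : b.1 * (1 + P.1 + T.1 + (P * T).1) * (b⁻¹).1 = 0 := by
    calc b.1 * (1 + P.1 + T.1 + (P * T).1) * (b⁻¹).1
        = (b * b⁻¹).1 + (b * P * b⁻¹).1 + (b * T * b⁻¹).1 +
            ((b * P * b⁻¹) * (b * T * b⁻¹)).1 := by
          have : (b * P * b⁻¹) * (b * T * b⁻¹) = b * (P * T) * b⁻¹ := by group
          rw [this]
          simp only [SO3.coe_mul, mul_add, add_mul, mul_one, mul_assoc]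
      _ = 0 := by
          rw [hb1, hb2, mul_inv_cancel]
          ext i j
          fin_cases i <;> fin_cases j <;> simp [Rx, Rz]
  calc 1 + P.1 + T.1 + (P * T).1
      = (b⁻¹ * b).1 * (1 + P.1 + T.1 + (P * T).1) * (b⁻¹ * b).1 := by simp
    _ = (b⁻¹).1 * (b.1 * (1 + P.1 + T.1 + (P * T).1) * (b⁻¹).1) * b.1 := by
        simp only [SO3.coe_mul, mul_assoc]
    _ = 0 := by rw [h]; simp

/-- A nontrivial endomorphism of `SO(3)` preserves traces. The trace of the image of `A` depends
only on the trace of `A`; write it as `4 g s - 1` when `A` has trace `4 s - 1`. The products of the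
half-turn about a unit vector `u` with those about the coordinate axes have traces `4 uᵢ² - 1`, and
the images of the latter sum to `-1`, so `∑ g (uᵢ²) = 1` for every `u`. -/
theorem tr_map_of_nontrivial (ρ : SO3 →* SO3) (h : ∃ A, ρ A ≠ 1) (A : SO3) :
    tr (ρ A) = tr A := by
  have hhalf : ∀ B : SO3, tr B = -1 → tr (ρ B) = -1 := by
    intro B hB
    apply tr_of_mul_self_eq_one
    · rw [← map_mul, mul_self_eq_one_of_tr hB, map_one]
    · intro h1
      obtain ⟨C, hC⟩ := h
      exact hC (map_eq_one_of_halfTurn ρ hB h1 C)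
  obtain ⟨f, hf, hf1⟩ : ∃ f : ℝ → ℝ, (∀ B, tr (ρ B) = f (tr B)) ∧ ∀ t, -1 ≤ f t := by
    classical
    -- A value `t` that is not a trace may be assigned any number `≥ -1`.
    refine ⟨fun t => if h : ∃ B, tr B = t then tr (ρ h.choose) else 0, fun B => ?_, fun t => ?_⟩
    · have hex : ∃ C, tr C = tr B := ⟨B, rfl⟩
      dsimp only
      rw [dif_pos hex]
      obtain ⟨Q, hQ⟩ := exists_conj_of_tr_eq hex.choose_spec
      conv_lhs => rw [hQ, map_mul, map_mul, map_inv, tr_conj]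
    · dsimp only
      split_ifs with h
      · exact neg_one_le_tr _
      · norm_num
  -- The images of the half-turns about the axes are again the half-turns of a Klein group.
  have hklein : 1 + (ρ Rz).1 + (ρ Rx).1 + (ρ Rz * ρ Rx).1 = 0 := by
    apply sum_klein (hhalf _ tr_Rz) (hhalf _ tr_Rx)
    · rw [← map_mul, Rz_mul_Rx, map_mul]
    · intro heq
      apply ne_one_of_tr (hhalf _ tr_Rz_mul_Rx)
      rw [map_mul, heq, ← map_mul, Rx_mul_self, map_one]
  have hsum : ∀ a b c : ℝ, 0 ≤ a → 0 ≤ b → 0 ≤ c → a + b + c = 1 →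
      (f (4 * a - 1) + 1) / 4 + (f (4 * b - 1) + 1) / 4 + (f (4 * c - 1) + 1) / 4 = 1 := by
    intro a b c ha hb hc habc
    obtain ⟨S, hS, hSx, hSy, hSz⟩ := exists_halfTurn ![√a, √b, √c] (by
      simp [Real.mul_self_sqrt, ha, hb, hc, habc])
    simp [Real.mul_self_sqrt, ha, hb, hc] at hSx hSy hSz
    have h1 : tr (ρ S) + tr (ρ S * ρ Rz) + tr (ρ S * ρ Rx) + tr (ρ S * (ρ Rz * ρ Rx)) = 0 := by
      have h2 := congrArg (fun M => ((ρ S).1 * M).trace) hklein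
      simpa only [tr, SO3.coe_mul, mul_add, mul_one, mul_zero, trace_add, trace_zero] using h2
    rw [hhalf _ hS, ← map_mul, ← map_mul, ← map_mul, ← map_mul, hf, hf, hf, hSx, hSy, hSz] at h1
    linarith
  have hg := eq_self_of_sum_eq_one (g := fun s => (f (4 * s - 1) + 1) / 4)
    (by
      have := hhalf _ tr_Rx
      rw [hf, tr_Rx] at this
      norm_num [this])
    (fun s => by
      have := hf1 (4 * s - 1)
      linarith)
    hsum (s := (tr A + 1) / 4) (by linarith [neg_one_le_tr A]) (by linarith [tr_le_three A])
  have h4 : 4 * ((tr A + 1) / 4) - 1 = tr A := by ring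
  simp only [h4] at hg
  rw [hf]
  linarith

/-! ### Endomorphisms of `SO(3)` are trivial or inner -/

/-- The rotations generated by `Rz`, `Rx` and `cyc` span the space of `3 × 3` matrices, so a
trace-preserving endomorphism that fixes these three is the identity. -/
theorem map_eq_self_of_fix {ρ : SO3 →* SO3} (htr : ∀ A, tr (ρ A) = tr A) (hz : ρ Rz = Rz)
    (hx : ρ Rx = Rx) (hc : ρ cyc = cyc) (A : SO3) : ρ A = A := by
  have key : ∀ B, ρ B = B → tr (ρ A * B) = tr (A * B) := by
    intro B hB
    conv_lhs => rw [← hB, ← map_mul, htr]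
  have e1 := key 1 (map_one ρ)
  have e2 := key Rz hz
  have e3 := key Rx hx
  have e4 := key (Rz * Rx) (by rw [map_mul, hz, hx])
  have e5 := key cyc hc
  have e6 := key (Rz * cyc) (by rw [map_mul, hz, hc])
  have e7 := key (Rx * cyc) (by rw [map_mul, hx, hc])
  have e8 := key (Rz * (Rx * cyc)) (by rw [map_mul, map_mul, hz, hx, hc])
  have e9 := key (cyc * cyc) (by rw [map_mul, hc])
  have e10 := key (Rz * (cyc * cyc)) (by rw [map_mul, map_mul, hz, hc])
  have e11 := key (Rx * (cyc * cyc)) (by rw [map_mul, map_mul, hx, hc])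
  have e12 := key (Rz * (Rx * (cyc * cyc))) (by rw [map_mul, map_mul, map_mul, hz, hx, hc])
  rw [tr_mul_fin_three, tr_mul_fin_three] at e1 e2 e3 e4 e5 e6 e7 e8 e9 e10 e11 e12
  simp [Rz, Rx, cyc] at e1 e2 e3 e4 e5 e6 e7 e8 e9 e10 e11 e12
  apply Subtype.ext
  ext i j
  fin_cases i <;> fin_cases j <;> simp <;> linarith

theorem diag_of_commute {P : SO3} (hz : P * Rz = Rz * P) (hx : P * Rx = Rx * P) :
    P.1 0 1 = 0 ∧ P.1 0 2 = 0 ∧ P.1 1 0 = 0 ∧ P.1 1 2 = 0 ∧ P.1 2 0 = 0 ∧ P.1 2 1 = 0 := by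
  have ez := fun i j => congrFun (congrFun (congrArg Subtype.val hz) i) j
  have ex := fun i j => congrFun (congrFun (congrArg Subtype.val hx) i) j
  have z02 := ez 0 2
  have z12 := ez 1 2
  have z20 := ez 2 0
  have z21 := ez 2 1
  have x01 := ex 0 1
  have x10 := ex 1 0
  simp [Rz, Rx, Matrix.mul_apply, Fin.sum_univ_three] at z02 z12 z20 z21 x01 x10
  refine ⟨?_, ?_, ?_, ?_, ?_, ?_⟩ <;> linarith

/-- `SO(3)` has trivial centre. -/
theorem eq_one_of_commute {P : SO3} (h : ∀ A, P * A = A * P) : P = 1 := by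
  obtain ⟨h01, h02, h10, h12, h20, h21⟩ := diag_of_commute (h Rz) (h Rx)
  have ec := fun i j => congrFun (congrFun (congrArg Subtype.val (h cyc)) i) j
  have c10 := ec 1 0
  have c21 := ec 2 1
  simp [cyc, Matrix.mul_apply, Fin.sum_univ_three] at c10 c21
  have hd := P.det_eq_one
  rw [det_fin_three, h01, h02, h10, h12, h20, h21, c21, c10] at hd
  have hp : P.1 0 0 = 1 := by
    have r0 := P.row_dot 0 0
    simp [h01, h02] at r0
    linear_combination hd - P.1 0 0 * r0
  apply Subtype.ext
  ext i j
  fin_cases i <;> fin_cases j <;> simp [h01, h02, h10, h12, h20, h21, c21, c10, hp]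

/-- The rotation `diag (x, y, z)` with `x, y, z = ±1` and `x y z = 1`. -/
theorem exists_diag {x y z : ℝ} (hx : x * x = 1) (hy : y * y = 1) (hz : z * z = 1)
    (h : x * y * z = 1) : ∃ D : SO3, D.1 = !![x, 0, 0; 0, y, 0; 0, 0, z] := by
  refine ⟨⟨_, ?_⟩, rfl⟩
  rw [mem_specialOrthogonalGroup_iff, mem_orthogonalGroup_iff]
  refine ⟨?_, by simp [det_fin_three, h]⟩
  ext i j
  fin_cases i <;> fin_cases j <;> simp [Matrix.mul_apply, Fin.sum_univ_three, hx, hy, hz]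

/-- A rotation acting on the half-turns about the axes as `cyc` does is a signed permutation
matrix, conjugate to `cyc` by a diagonal rotation. -/
theorem exists_diag_conj_cyc {M : SO3} (hz : M * Rz = Rx * M) (hx : M * Rx = Rz * Rx * M) :
    ∃ D : SO3, D * Rz * D⁻¹ = Rz ∧ D * Rx * D⁻¹ = Rx ∧ D * M * D⁻¹ = cyc := by
  have ez := fun i j => congrFun (congrFun (congrArg Subtype.val hz) i) j
  have ex := fun i j => congrFun (congrFun (congrArg Subtype.val hx) i) j
  have z00 := ez 0 0
  have z01 := ez 0 1
  have z12 := ez 1 2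
  have z22 := ez 2 2
  have x11 := ex 1 1
  have x20 := ex 2 0
  simp [Rz, Rx, Matrix.mul_apply, Fin.sum_univ_three] at z00 z01 z12 z22 x11 x20
  have h00 : M.1 0 0 = 0 := by linarith
  have h01 : M.1 0 1 = 0 := by linarith
  have h12 : M.1 1 2 = 0 := by linarith
  have h22 : M.1 2 2 = 0 := by linarith
  have h11 : M.1 1 1 = 0 := by linarith
  have h20 : M.1 2 0 = 0 := by linarith
  have r0 := M.row_dot 0 0
  have r1 := M.row_dot 1 1
  have r2 := M.row_dot 2 2
  have hd := M.det_eq_one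
  rw [det_fin_three] at hd
  simp [h00, h01, h12, h22, h11, h20] at r0 r1 r2 hd
  -- The nonzero entries of `M` are `M₀₂`, `M₁₀`, `M₂₁`, of product `1`; conjugation by
  -- `diag (M₂₁, M₀₂, M₁₀)` turns all three into `1`.
  obtain ⟨D, hD⟩ := exists_diag (x := M.1 2 1) (y := M.1 0 2) (z := M.1 1 0)
    (by linarith) (by linarith) (by linarith) (by linarith)
  refine ⟨D, ?_, ?_, ?_⟩ <;> rw [mul_inv_eq_iff_eq_mul] <;> apply Subtype.ext <;>
    rw [SO3.coe_mul, SO3.coe_mul, hD] <;> ext i j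
  · fin_cases i <;> fin_cases j <;> simp [Rz, Matrix.mul_apply, Fin.sum_univ_three]
  · fin_cases i <;> fin_cases j <;> simp [Rx, Matrix.mul_apply, Fin.sum_univ_three]
  · fin_cases i <;> fin_cases j <;>
      simp [cyc, Matrix.mul_apply, Fin.sum_univ_three, h00, h01, h12, h22, h11, h20]
    · linear_combination M.1 1 0 * hd - M.1 2 1 * M.1 0 2 * r1
    · linear_combination M.1 2 1 * hd - M.1 0 2 * M.1 1 0 * r2
    · linear_combination M.1 0 2 * hd - M.1 1 0 * M.1 2 1 * r0

/-- A nontrivial endomorphism of `SO(3)` is inner. -/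
theorem exists_conj_of_nontrivial (ρ : SO3 →* SO3) (h : ∃ A, ρ A ≠ 1) :
    ∃ b : SO3, ∀ A, b * ρ A * b⁻¹ = A := by
  have htr := tr_map_of_nontrivial ρ h
  obtain ⟨b, hbz, hbx⟩ := exists_conj_pair (P := ρ Rz) (T := ρ Rx) (by rw [htr, tr_Rz])
    (by rw [htr, tr_Rx]) (by rw [← map_mul, Rz_mul_Rx, map_mul]) (by
      intro heq
      apply ne_one_of_tr ((htr _).trans tr_Rz_mul_Rx)
      rw [map_mul, heq, ← map_mul, Rx_mul_self, map_one])
  have hcz : cyc * Rz = Rx * cyc := by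
    apply Subtype.ext
    ext i j
    fin_cases i <;> fin_cases j <;> simp [Rz, Rx, cyc]
  have hcx : cyc * Rx = Rz * Rx * cyc := by
    apply Subtype.ext
    ext i j
    fin_cases i <;> fin_cases j <;> simp [Rz, Rx, cyc]
  obtain ⟨D, hDz, hDx, hDc⟩ := exists_diag_conj_cyc (M := b * ρ cyc * b⁻¹)
    (by
      calc b * ρ cyc * b⁻¹ * Rz = b * (ρ cyc * ρ Rz) * b⁻¹ := by
            conv_lhs => rw [← hbz]
            group
        _ = (b * ρ Rx * b⁻¹) * (b * ρ cyc * b⁻¹) := by rw [← map_mul, hcz, map_mul]; group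
        _ = Rx * (b * ρ cyc * b⁻¹) := by rw [hbx])
    (by
      calc b * ρ cyc * b⁻¹ * Rx = b * (ρ cyc * ρ Rx) * b⁻¹ := by
            conv_lhs => rw [← hbx]
            group
        _ = (b * ρ Rz * b⁻¹) * (b * ρ Rx * b⁻¹) * (b * ρ cyc * b⁻¹) := by
          rw [← map_mul, hcx, map_mul, map_mul]; group
        _ = Rz * Rx * (b * ρ cyc * b⁻¹) := by rw [hbx, hbz])
  have happ : ∀ A, ((MulAut.conj (D * b)).toMonoidHom.comp ρ) A = D * (b * ρ A * b⁻¹) * D⁻¹ := by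
    intro A
    simp [mul_assoc]
  refine ⟨D * b, fun A => ?_⟩
  refine map_eq_self_of_fix (ρ := (MulAut.conj (D * b)).toMonoidHom.comp ρ) (fun B => ?_) ?_ ?_ ?_ A
  · rw [happ, tr_conj, tr_conj, htr]
  · rw [happ, hbz, hDz]
  · rw [happ, hbx, hDx]
  · rw [happ, hDc]

/-! ### Homomorphisms from `O(3) × Z₂^𝒯` to `SO(3)` -/

/-- The inclusion of `SO(3)` in `O(3)`. -/
def inclSO3 : SO3 →* O3 where
  toFun A := ⟨A.1, (mem_specialOrthogonalGroup_iff.mp A.2).1⟩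
  map_one' := rfl
  map_mul' _ _ := rfl

/-- The inversion `-E` in `O(3)`. -/
def inversion : O3 :=
  ⟨-1, by simp [mem_orthogonalGroup_iff]⟩

/-- The generator `𝒯` of `Z₂^𝒯`. -/
def timeRev : Z2T := Multiplicative.ofAdd 1

theorem det_inversion : inversion.1.det = -1 := by
  norm_num [inversion, det_neg]

theorem inversion_mul_self : inversion * inversion = 1 := by
  apply Subtype.ext
  simp [inversion]

theorem timeRev_mul_self : timeRev * timeRev = 1 := by decide

theorem inversion_comm (g : O3) : inversion * g = g * inversion := by
  apply Subtype.ext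
  simp [inversion]

theorem eta_inversion : eta inversion = 1 := by
  norm_num [eta, det_inversion]

theorem eta_one : eta 1 = 0 := by simp [eta]

theorem eps_timeRev : eps timeRev = 1 := by decide

theorem eps_one : eps 1 = 0 := by decide

theorem eq_timeRev_pow : ∀ t : Z2T, t = timeRev ^ eps t := by decide

/-- `O(3) × Z₂^𝒯` is the product of `SO(3)` and the groups of order two generated by the inversion
and by `𝒯`; the projection onto the factor `SO(3)` is `phi6`. -/
theorem eq_rotation_mul (x : O3 × Z2T) :
    x = (inclSO3 (phi6 x), 1) * (inversion, 1) ^ eta x.1 * (1, timeRev) ^ eps x.2 := by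
  refine Prod.ext ?_ ?_
  · apply Subtype.ext
    rcases det_eq x.1 with h | h
    · simp [inclSO3, phi6_apply, eta, h]
    · norm_num [inclSO3, phi6_apply, eta, h, inversion]
  · simpa using eq_timeRev_pow x.2

theorem map_eq_mul {G : Type*} [Group G] (f : O3 × Z2T →* G) (x : O3 × Z2T) :
    f x = f (inclSO3 (phi6 x), 1) * f (inversion, 1) ^ eta x.1 * f (1, timeRev) ^ eps x.2 := by
  conv_lhs => rw [eq_rotation_mul x, map_mul, map_mul, map_pow, map_pow]

/-- Every homomorphism to `SO(3)` is conjugate to one of the standard six. If its restriction to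
`SO(3)` is nontrivial, it is inner there and kills the inversion and `𝒯`, whose images centralise
`SO(3)`; otherwise it is given by the images of these two, commuting involutions. -/
theorem exists_conjugate_mem_Phi (f : O3 × Z2T →ₜ* SO3) : ∃ φ ∈ Phi, Conjugate f φ := by
  set P := f (inversion, 1) with hPdef
  set T := f (1, timeRev) with hTdef
  have hf : ∀ x, f x = f (inclSO3 (phi6 x), 1) * P ^ eta x.1 * T ^ eps x.2 :=
    map_eq_mul f.toMonoidHom
  have hP : P * P = 1 := by
    rw [hPdef, ← map_mul, Prod.mk_mul_mk, inversion_mul_self, mul_one]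
    exact map_one f
  have hT : T * T = 1 := by
    rw [hTdef, ← map_mul, Prod.mk_mul_mk, timeRev_mul_self, mul_one]
    exact map_one f
  have hPT : P * T = T * P := by
    rw [hPdef, hTdef, ← map_mul, ← map_mul]
    simp
  let ρ : SO3 →* SO3 := f.toMonoidHom.comp ((MonoidHom.inl O3 Z2T).comp inclSO3)
  have hρ : ∀ A, ρ A = f (inclSO3 A, 1) := fun _ => rfl
  by_cases h : ∃ A, ρ A ≠ 1
  · obtain ⟨b, hb⟩ := exists_conj_of_nontrivial ρ h
    have hcent : ∀ C : SO3, (∀ A, C * ρ A = ρ A * C) → C = 1 := by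
      intro C hC
      rw [← conj_eq_one_iff (a := b)]
      apply eq_one_of_commute
      intro A
      calc b * C * b⁻¹ * A = b * C * b⁻¹ * (b * ρ A * b⁻¹) := by rw [hb]
        _ = b * (C * ρ A) * b⁻¹ := by group
        _ = b * ρ A * b⁻¹ * (b * C * b⁻¹) := by rw [hC]; group
        _ = A * (b * C * b⁻¹) := by rw [hb]
    have hP1 : P = 1 := by
      apply hcent
      intro A
      rw [hρ, hPdef, ← map_mul, ← map_mul, Prod.mk_mul_mk, Prod.mk_mul_mk, inversion_comm]
    have hT1 : T = 1 := by
      apply hcent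
      intro A
      rw [hρ, hTdef, ← map_mul, ← map_mul]
      simp
    refine ⟨phi6, by simp [Phi], b, fun x => ?_⟩
    rw [hf, hP1, hT1, one_pow, one_pow, mul_one, mul_one, ← hρ, hb]
  · push Not at h
    have hf' : ∀ x, f x = P ^ eta x.1 * T ^ eps x.2 := by
      intro x
      rw [hf, ← hρ, h, one_mul]
    by_cases hP1 : P = 1
    · by_cases hT1 : T = 1
      · refine ⟨phi1, by simp [Phi], 1, fun x => ?_⟩
        simp [hf', hP1, hT1, phi1_apply]
      · obtain ⟨b, hb⟩ := exists_conj_of_tr_eq ((tr_of_mul_self_eq_one hT hT1).trans tr_Rz.symm)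
        refine ⟨phi2, by simp [Phi], b, fun x => ?_⟩
        rw [hf', hP1, one_pow, one_mul, phi2_apply, hb, conj_pow]
    · have htP := tr_of_mul_self_eq_one hP hP1
      obtain ⟨b, hb⟩ := exists_conj_of_tr_eq (htP.trans tr_Rz.symm)
      by_cases hT1 : T = 1
      · refine ⟨phi3, by simp [Phi], b, fun x => ?_⟩
        rw [hf', hT1, one_pow, mul_one, phi3_apply, hb, conj_pow]
      · by_cases hPT1 : P = T
        · refine ⟨phi4, by simp [Phi], b, fun x => ?_⟩
          rw [hf', ← hPT1, ← pow_add, phi4_apply, hb, conj_pow]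
        · obtain ⟨b, hbP, hbT⟩ := exists_conj_pair htP (tr_of_mul_self_eq_one hT hT1) hPT hPT1
          refine ⟨phi5, by simp [Phi], b, fun x => ?_⟩
          rw [hf', phi5_apply, ← hbP, ← hbT, conj_pow, conj_pow]
          group

/-! ### The six homomorphisms are pairwise not conjugate -/

theorem Conjugate.eq_one_iff {A B : Type*} [Monoid A] [TopologicalSpace A] [Group B]
    [TopologicalSpace B] {f g : A →ₜ* B} (h : Conjugate f g) (a : A) : f a = 1 ↔ g a = 1 := by
  obtain ⟨b, hb⟩ := h
  rw [hb, conj_eq_one_iff]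

/-- Which of `-E`, `𝒯`, `-𝒯` and `R_z(π)` a homomorphism kills. -/
def killed (f : O3 × Z2T →ₜ* SO3) : Prop × Prop × Prop × Prop :=
  (f (inversion, 1) = 1, f (1, timeRev) = 1, f (inversion, timeRev) = 1, f (inclSO3 Rz, 1) = 1)

theorem Conjugate.killed_eq {f g : O3 × Z2T →ₜ* SO3} (h : Conjugate f g) :
    killed f = killed g := by
  simp only [killed, h.eq_one_iff]

theorem eta_inclSO3 (A : SO3) : eta (inclSO3 A) = 0 := by
  simp [eta, inclSO3, A.det_eq_one]

theorem phi6_inclSO3 (A : SO3) (t : Z2T) : phi6 (inclSO3 A, t) = A := by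
  apply Subtype.ext
  simp [phi6_apply, inclSO3, A.det_eq_one]

theorem phi6_inversion (t : Z2T) : phi6 (inversion, t) = 1 := by
  apply Subtype.ext
  rw [phi6_apply, det_inversion]
  simp [inversion]

theorem phi6_one (t : Z2T) : phi6 (1, t) = 1 := by
  apply Subtype.ext
  simp [phi6_apply]

theorem Rz_ne_one : Rz ≠ 1 := ne_one_of_tr tr_Rz

theorem Rx_ne_one : Rx ≠ 1 := ne_one_of_tr tr_Rx

theorem killed_phi1 : killed phi1 = (True, True, True, True) := by
  simp [killed, phi1_apply]

theorem killed_phi2 : killed phi2 = (True, False, False, True) := by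
  simp [killed, phi2_apply, eps_one, eps_timeRev, Rz_ne_one]

theorem killed_phi3 : killed phi3 = (False, True, False, True) := by
  simp [killed, phi3_apply, eta_one, eta_inversion, eta_inclSO3, Rz_ne_one]

theorem killed_phi4 : killed phi4 = (False, False, True, True) := by
  simp [killed, phi4_apply, eta_one, eta_inversion, eta_inclSO3, eps_one, eps_timeRev, Rz_ne_one,
    pow_two, Rz_mul_self]

theorem killed_phi5 : killed phi5 = (False, False, False, True) := by
  simp [killed, phi5_apply, eta_one, eta_inversion, eta_inclSO3, eps_one, eps_timeRev, Rz_ne_one,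
    Rx_ne_one, ne_one_of_tr tr_Rz_mul_Rx]

theorem killed_phi6 : killed phi6 = (True, True, True, False) := by
  simp [killed, phi6_inclSO3, phi6_inversion, phi6_one, Rz_ne_one]

theorem killed_injOn : Set.InjOn killed Phi := by
  intro α hα β hβ h
  simp only [Phi, Set.mem_insert_iff, Set.mem_singleton_iff] at hα hβ
  rcases hα with rfl | rfl | rfl | rfl | rfl | rfl <;>
    rcases hβ with rfl | rfl | rfl | rfl | rfl | rfl <;>
    first
    | rfl
    | simp [killed_phi1, killed_phi2, killed_phi3, killed_phi4, killed_phi5, killed_phi6] at h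

theorem ncard_Phi : Phi.ncard = 6 := by
  have hne : ∀ {α β}, killed α ≠ killed β → α ≠ β := fun h e => h (congrArg killed e)
  rw [Phi, Set.ncard_insert_of_notMem, Set.ncard_insert_of_notMem, Set.ncard_insert_of_notMem,
    Set.ncard_insert_of_notMem, Set.ncard_pair]
  all_goals
    try simp only [Set.mem_insert_iff, Set.mem_singleton_iff, not_or]
    and_intros
  all_goals
    refine hne ?_
    simp [killed_phi1, killed_phi2, killed_phi3, killed_phi4, killed_phi5, killed_phi6]

/-! ### Pairs of homomorphisms and the number of classes -/

theorem conjugate_prod_iff {f : O3 × Z2T →ₜ* SO3 × SO3} {α β : O3 × Z2T →ₜ* SO3} :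
    Conjugate f (α.prod β) ↔ Conjugate ((ContinuousMonoidHom.fst SO3 SO3).comp f) α ∧
      Conjugate ((ContinuousMonoidHom.snd SO3 SO3).comp f) β := by
  constructor
  · rintro ⟨b, hb⟩
    exact ⟨⟨b.1, fun a => congrArg Prod.fst (hb a)⟩, ⟨b.2, fun a => congrArg Prod.snd (hb a)⟩⟩
  · rintro ⟨⟨b, hb⟩, ⟨c, hc⟩⟩
    exact ⟨(b, c), fun a => Prod.ext (hb a) (hc a)⟩

theorem existsUnique_conjugate_pair (f : O3 × Z2T →ₜ* SO3 × SO3) :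
    ∃! p : (O3 × Z2T →ₜ* SO3) × (O3 × Z2T →ₜ* SO3),
      p ∈ Phi ×ˢ Phi ∧ Conjugate f (p.1.prod p.2) := by
  obtain ⟨α, hα, hfα⟩ := exists_conjugate_mem_Phi ((ContinuousMonoidHom.fst SO3 SO3).comp f)
  obtain ⟨β, hβ, hfβ⟩ := exists_conjugate_mem_Phi ((ContinuousMonoidHom.snd SO3 SO3).comp f)
  refine ⟨(α, β), ⟨⟨hα, hβ⟩, conjugate_prod_iff.mpr ⟨hfα, hfβ⟩⟩, ?_⟩
  rintro ⟨α', β'⟩ ⟨⟨hα', hβ'⟩, h⟩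
  obtain ⟨hfα', hfβ'⟩ := conjugate_prod_iff.mp h
  exact Prod.ext (killed_injOn hα' hα (hfα'.killed_eq.symm.trans hfα.killed_eq))
    (killed_injOn hβ' hβ (hfβ'.killed_eq.symm.trans hfβ.killed_eq))

theorem card_conjugacy_classes :
    Nat.card (Quotient (conjugateSetoid (O3 × Z2T) (SO3 × SO3))) = 36 := by
  have hbij : Function.Bijective
      (fun p : (Phi ×ˢ Phi : Set _) =>
        (Quotient.mk (conjugateSetoid (O3 × Z2T) (SO3 × SO3)) (p.1.1.prod p.1.2))) := by
    constructor
    · intro p q hpq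
      have h : Conjugate (p.1.1.prod p.1.2) (q.1.1.prod q.1.2) := Quotient.exact hpq
      have hrefl : Conjugate (p.1.1.prod p.1.2) (p.1.1.prod p.1.2) :=
        (conjugateSetoid (O3 × Z2T) (SO3 × SO3)).refl _
      exact Subtype.ext ((existsUnique_conjugate_pair _).unique ⟨p.2, hrefl⟩ ⟨q.2, h⟩)
    · intro c
      induction c using Quotient.inductionOn with
      | _ f =>
        obtain ⟨p, ⟨hp, hfp⟩, -⟩ := existsUnique_conjugate_pair f
        exact ⟨⟨p, hp⟩, Quotient.sound
          ((conjugateSetoid (O3 × Z2T) (SO3 × SO3)).symm hfp)⟩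
  rw [← Nat.card_eq_of_bijective _ hbij, Nat.card_coe_set_eq, Set.ncard_prod, ncard_Phi]

end SpinCharge

end

theorem mainTheorem1 :
    SpinCharge.Phi.ncard = 6 ∧
    (∀ f : SpinCharge.O3 × SpinCharge.Z2T →ₜ* SpinCharge.SO3 × SpinCharge.SO3,
      ∃! p : (SpinCharge.O3 × SpinCharge.Z2T →ₜ* SpinCharge.SO3) ×
          (SpinCharge.O3 × SpinCharge.Z2T →ₜ* SpinCharge.SO3),
        p ∈ SpinCharge.Phi ×ˢ SpinCharge.Phi ∧
          SpinCharge.Conjugate f (p.1.prod p.2)) ∧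
    Nat.card (Quotient (SpinCharge.conjugateSetoid (SpinCharge.O3 × SpinCharge.Z2T)
      (SpinCharge.SO3 × SpinCharge.SO3))) = 36 :=
  ⟨SpinCharge.ncard_Phi, SpinCharge.existsUnique_conjugate_pair,
    SpinCharge.card_conjugacy_classes⟩
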